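/- Let $N_1,N_2\ge 0$ be integers. Consider the peakon ODEs of the Geng--Xue equation \[ \dot x_k = u(x_k)\,v(x_k),\qquad \dot m_k = m_k\bigl(u(x_k)\,v_x(x_k)-2u_x(x_k)\,v(x_k)\bigr)\qquad(1\le k\le N_1), \] \[ \dot y_k = u(y_k)\,v(y_k),\qquad \dot n_k = n_k\bigl(u_x(y_k)\,v(y_k)-2u(y_k)\,v_x(y_k)\bigr)\qquad(1\le k\le N_2), \] where $u(z)=\sum_{i=1}^{N_1} m_i e^{-|z-x_i|}$, $v(z)=\sum_{i=1}^{N_2} n_i e^{-|z-y_i|}$, and $u_x$, $v_x$ denote the averages of the left and right derivatives, i.e. $u_x(z)=-\sum_i m_i\,\mathrm{sgn}(z-x_i)\,e^{-|z-x_i|}$ and $v_x(z)=-\sum_i n_i\,\mathrm{sgn}(z-y_i)\,e^{-|z-y_i|}$ with $\mathrm{sgn}(0)=0$. Call a configuration $(x_k,y_k,m_k,n_k)$ a pure peakon configuration if $x_1<\dots<x_{N_1}$, $y_1<\dots<y_{N_2}$, $x_i\ne y_j$ for all $i,j$, and all amplitudes $m_i$, $n_j$ are positive (the $x$'s and $y$'s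 need not interlace). Let $t_0\in\mathbb R$ and let a pure peakon configuration be given as initial data at time $t_0$. Then: (a) (No collisions.) For every solution of the ODEs with these initial data, on any interval $I\ni t_0$, the configuration is a pure peakon configuration for all $t\in I$, and the strict ordering of all $N_1+N_2$ positions is the same at every $t\in I$ as at $t_0$. (b) (Globality.) There is a solution with these initial data defined for all $t\in\mathbb R$; it is a pure peakon configuration with the same strict ordering of all $N_1+N_2$ positions for every $t\in\mathbb R$; and every solution with these initial data on an interval $I\ni t_0$ is the restriction of it to $I$. -/

import Mathlib

open Set

/-- The variables of a Geng–Xue multipeakon with `N₁` peakons in `u` and `N₂` peakons in `v`: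
positions `x k` and amplitudes `m k` of the peakons in `u`, positions `y k` and amplitudes `n k`
of the peakons in `v`. -/
@[ext]
structure PeakonConfig (N₁ N₂ : ℕ) where
  x : Fin N₁ → ℝ
  y : Fin N₂ → ℝ
  m : Fin N₁ → ℝ
  n : Fin N₂ → ℝ

/-- The superposition of peakons `z ↦ ∑ i, a i * exp (-|z - c i|)`. -/
noncomputable def peakonSum {N : ℕ} (a c : Fin N → ℝ) (z : ℝ) : ℝ :=
  ∑ i, a i * Real.exp (-|z - c i|)

/-- The average of the left and right derivatives of `peakonSum a c` at `z`
(with `Real.sign 0 = 0`). -/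
noncomputable def peakonSumDeriv {N : ℕ} (a c : Fin N → ℝ) (z : ℝ) : ℝ :=
  -∑ i, a i * Real.sign (z - c i) * Real.exp (-|z - c i|)

namespace PeakonConfig

variable {N₁ N₂ : ℕ}

/-- The component `u` of the multipeakon. -/
noncomputable def u (p : PeakonConfig N₁ N₂) (z : ℝ) : ℝ := peakonSum p.m p.x z

/-- The component `v` of the multipeakon. -/
noncomputable def v (p : PeakonConfig N₁ N₂) (z : ℝ) : ℝ := peakonSum p.n p.y z

/-- The averaged derivative of `u`. -/
noncomputable def ux (p : PeakonConfig N₁ N₂) (z : ℝ) : ℝ := peakonSumDeriv p.m p.x z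

/-- The averaged derivative of `v`. -/
noncomputable def vx (p : PeakonConfig N₁ N₂) (z : ℝ) : ℝ := peakonSumDeriv p.n p.y z

/-- Pure peakon configurations: the peakons of each component are labelled in strictly increasing
order, no peakon of `u` overlaps one of `v`, and all amplitudes are positive. No relation between
the `x`'s and the `y`'s (such as interlacing) is imposed. -/
structure IsPure (p : PeakonConfig N₁ N₂) : Prop where
  x_strictMono : StrictMono p.x
  y_strictMono : StrictMono p.y
  x_ne_y : ∀ i j, p.x i ≠ p.y j
  m_pos : ∀ i, 0 < p.m i
  n_pos : ∀ j, 0 < p.n j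

/-- The positions of all `N₁ + N₂` peakons together. -/
def pos (p : PeakonConfig N₁ N₂) : Fin N₁ ⊕ Fin N₂ → ℝ := Sum.elim p.x p.y

/-- The positions of the peakons of `p` and of `q` are in the same strict order. -/
def SameOrder (p q : PeakonConfig N₁ N₂) : Prop :=
  ∀ a b : Fin N₁ ⊕ Fin N₂, p.pos a < p.pos b ↔ q.pos a < q.pos b

end PeakonConfig

/-- `p` satisfies the Geng–Xue peakon ODEs on the set `I` of times (in the theorem, `I` is an
interval; derivatives at an end point that belongs to `I` are one-sided). -/
structure IsPeakonSolutionOn {N₁ N₂ : ℕ} (p : ℝ → PeakonConfig N₁ N₂) (I : Set ℝ) : Prop where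
  x_ode : ∀ t ∈ I, ∀ k, HasDerivWithinAt (fun s => (p s).x k)
    ((p t).u ((p t).x k) * (p t).v ((p t).x k)) I t
  y_ode : ∀ t ∈ I, ∀ k, HasDerivWithinAt (fun s => (p s).y k)
    ((p t).u ((p t).y k) * (p t).v ((p t).y k)) I t
  m_ode : ∀ t ∈ I, ∀ k, HasDerivWithinAt (fun s => (p s).m k)
    ((p t).m k * ((p t).u ((p t).x k) * (p t).vx ((p t).x k)
      - 2 * (p t).ux ((p t).x k) * (p t).v ((p t).x k))) I t
  n_ode : ∀ t ∈ I, ∀ k, HasDerivWithinAt (fun s => (p s).n k)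
    ((p t).n k * ((p t).ux ((p t).y k) * (p t).v ((p t).y k)
      - 2 * (p t).u ((p t).y k) * (p t).vx ((p t).y k))) I t

/-! ### Linear differential inequalities; locally Lipschitz ODEs -/

section ODE

open Metric Filter Topology NNReal

/-! On a compact time interval the amplitudes are bounded, so `z ↦ u z * v z` is Lipschitz uniformly
in time. Hence every difference of two positions, and likewise every amplitude, satisfies `|f'| ≤ C
* |f|` and cannot reach zero. This gives (a).

For (b), the only discontinuity of the ODEs comes from the signs in `ux` and `vx`. Freezing them at
their initial values yields a locally Lipschitz field (`locallyLipschitz_field`). The argument for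
(a) needs only that the signs are bounded by 1, so frozen solutions keep their order and the frozen
signs remain the true ones.

Blow-up is excluded by the conserved `energy`, which dominates `u * v` everywhere when the
amplitudes are nonnegative (`u_mul_v_le_energy`): velocities are at most the energy, logarithmic
derivatives of amplitudes at most three times it. Conservation rests on the Wronskian `u * vx - ux *
v` being a combination of sign functions with jumps at the peakons (`wronskian_eq`), which makes the
terms of the derivative cancel by antisymmetry. -/

theorem HasDerivWithinAt.sq_mul_exp_monotoneOn {J : Set ℝ} (hJ : J.OrdConnected) {f f' : ℝ → ℝ}
    {C : ℝ} (hf : ∀ t ∈ J, HasDerivWithinAt f (f' t) J t) (hC : ∀ t ∈ J, |f' t| ≤ C * |f t|) :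
    MonotoneOn (fun t => f t ^ 2 * Real.exp (2 * C * t)) J := by
  have hd : ∀ t ∈ J, HasDerivWithinAt (fun t => f t ^ 2 * Real.exp (2 * C * t))
      (2 * (f t * f' t + C * f t ^ 2) * Real.exp (2 * C * t)) J t := by
    intro t ht
    have h1 := ((hf t ht).pow 2).mul
      (((hasDerivAt_id t).const_mul (2 * C)).exp.hasDerivWithinAt (s := J))
    refine h1.congr_deriv ?_
    simp
    ring
  refine monotoneOn_of_hasDerivWithinAt_nonneg hJ.convex
    (fun t ht => (hd t ht).continuousWithinAt)
    (fun t ht => (hd t (interior_subset ht)).mono interior_subset) (fun t ht => ?_)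
  have h1 : |f t * f' t| ≤ C * f t ^ 2 := by
    rw [abs_mul, ← sq_abs (f t)]
    nlinarith [hC t (interior_subset ht), abs_nonneg (f t)]
  have h2 := (abs_le.1 h1).1
  have := Real.exp_pos (2 * C * t)
  have h3 : 0 ≤ f t * f' t + C * f t ^ 2 := by linarith
  positivity

/-- A two-sided Grönwall bound: squaring avoids differentiating `|f|`, and reflecting time handles
the case `t ≤ s`. -/
theorem abs_le_abs_mul_exp_of_abs_deriv_le {J : Set ℝ} (hJ : J.OrdConnected) {f f' : ℝ → ℝ}
    {C : ℝ} (hf : ∀ t ∈ J, HasDerivWithinAt f (f' t) J t) (hC : ∀ t ∈ J, |f' t| ≤ C * |f t|)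
    {s t : ℝ} (hs : s ∈ J) (ht : t ∈ J) : |f s| ≤ |f t| * Real.exp (C * |t - s|) := by
  have key : f s ^ 2 ≤ f t ^ 2 * Real.exp (2 * (C * |t - s|)) := by
    rcases le_total s t with h | h
    · have h1 := HasDerivWithinAt.sq_mul_exp_monotoneOn hJ hf hC hs ht h
      rw [abs_of_nonneg (sub_nonneg.2 h), show 2 * (C * (t - s)) = 2 * C * t - 2 * C * s by ring,
        Real.exp_sub, ← mul_div_assoc, le_div_iff₀ (Real.exp_pos _)]
      exact h1
    · have hJ' : (Neg.neg ⁻¹' J : Set ℝ).OrdConnected :=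
        ⟨fun a ha b hb c hc => hJ.out hb ha ⟨neg_le_neg hc.2, neg_le_neg hc.1⟩⟩
      have hf' : ∀ r ∈ (Neg.neg ⁻¹' J : Set ℝ), HasDerivWithinAt (fun r => f (-r)) (-f' (-r))
          (Neg.neg ⁻¹' J) r := by
        intro r hr
        have := (hf (-r) hr).comp r (hasDerivAt_neg r).hasDerivWithinAt
          (fun x (hx : x ∈ Neg.neg ⁻¹' J) => hx)
        exact this.congr_deriv (by ring)
      have h1 := HasDerivWithinAt.sq_mul_exp_monotoneOn (C := C) hJ' hf'
        (fun r hr => by simpa using hC (-r) hr) (a := -s) (b := -t) (by simpa) (by simpa)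
        (neg_le_neg h)
      simp only [neg_neg] at h1
      rw [abs_of_nonpos (sub_nonpos.2 h),
        show 2 * (C * -(t - s)) = 2 * C * -t - 2 * C * -s by ring,
        Real.exp_sub, ← mul_div_assoc, le_div_iff₀ (Real.exp_pos _)]
      exact h1
  refine abs_le_of_sq_le_sq' ?_ (by positivity) |> abs_le.2
  rw [mul_pow, sq_abs, ← Real.exp_nat_mul]
  exact_mod_cast key

/-- A change of sign would force a zero, and the Grönwall bound from that zero would make `f s`
vanish too. -/
theorem pos_of_abs_deriv_le_mul_abs {J : Set ℝ} (hJ : J.OrdConnected) {f f' : ℝ → ℝ}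
    {C : ℝ} (hf : ∀ t ∈ J, HasDerivWithinAt f (f' t) J t) (hC : ∀ t ∈ J, |f' t| ≤ C * |f t|)
    {s t : ℝ} (hs : s ∈ J) (ht : t ∈ J) (h : 0 < f s) : 0 < f t := by
  by_contra! hneg
  obtain ⟨r, hr, hr0⟩ := hJ.isPreconnected.intermediate_value ht hs
    (fun t ht => (hf t ht).continuousWithinAt) ⟨hneg, h.le⟩
  have := abs_le_abs_mul_exp_of_abs_deriv_le hJ hf hC hs hr
  rw [hr0, abs_zero, zero_mul] at this
  exact absurd (abs_pos.2 h.ne') (not_lt.2 this)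

theorem LocallyLipschitz.exists_lipschitzOnWith_closedBall {E : Type*}
    [NormedAddCommGroup E] [ProperSpace E] {F : E → E}
    (hF : LocallyLipschitz F) (x : E) (r : ℝ) : ∃ K, LipschitzOnWith K F (closedBall x r) :=
  hF.locallyLipschitzOn.exists_lipschitzOnWith_of_compact (isCompact_closedBall x r)

variable {E : Type*} [NormedAddCommGroup E] [NormedSpace ℝ E]

/-- Between `t₀` and `t` both curves stay in one closed ball, on which the field is Lipschitz. -/
theorem LocallyLipschitz.eqOn_of_hasDerivWithinAt [ProperSpace E] {F : E → E}
    (hF : LocallyLipschitz F) {I : Set ℝ} (hI : I.OrdConnected) {t₀ : ℝ} (ht₀ : t₀ ∈ I)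
    {f g : ℝ → E} (hf : ∀ t ∈ I, HasDerivWithinAt f (F (f t)) I t)
    (hg : ∀ t ∈ I, HasDerivWithinAt g (F (g t)) I t) (h : f t₀ = g t₀) : EqOn f g I := by
  intro t ht
  have hsub : uIcc t₀ t ⊆ I := hI.uIcc_subset ht₀ ht
  have hfc : ContinuousOn f (uIcc t₀ t) := fun s hs =>
    (hf s (hsub hs)).continuousWithinAt.mono hsub
  have hgc : ContinuousOn g (uIcc t₀ t) := fun s hs =>
    (hg s (hsub hs)).continuousWithinAt.mono hsub
  obtain ⟨R, hR⟩ := ((isCompact_uIcc.image_of_continuousOn hfc).union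
    (isCompact_uIcc.image_of_continuousOn hgc)).isBounded.subset_closedBall (0 : E)
  obtain ⟨K, hK⟩ := hF.exists_lipschitzOnWith_closedBall 0 R
  have hfR : ∀ s ∈ uIcc t₀ t, f s ∈ closedBall (0 : E) R := fun s hs =>
    hR (Or.inl (mem_image_of_mem f hs))
  have hgR : ∀ s ∈ uIcc t₀ t, g s ∈ closedBall (0 : E) R := fun s hs =>
    hR (Or.inr (mem_image_of_mem g hs))
  rcases le_total t₀ t with hle | hle
  · rw [uIcc_of_le hle] at *
    have aux : ∀ {φ : ℝ → E}, (∀ t ∈ I, HasDerivWithinAt φ (F (φ t)) I t) →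
        ∀ s ∈ Ico t₀ t, HasDerivWithinAt φ (F (φ s)) (Ici s) s := fun hφ s hs =>
      ((hφ s (hsub (Ico_subset_Icc_self hs))).mono hsub).mono_of_mem_nhdsWithin
        (Filter.mem_of_superset (Icc_mem_nhdsGE hs.2) (Icc_subset_Icc_left hs.1))
    exact ODE_solution_unique_of_mem_Icc_right (v := fun _ => F)
      (s := fun _ => closedBall 0 R) (fun _ _ => hK) hfc (aux hf)
      (fun s hs => hfR s (Ico_subset_Icc_self hs)) hgc (aux hg)
      (fun s hs => hgR s (Ico_subset_Icc_self hs)) h ⟨hle, le_rfl⟩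
  · rw [uIcc_of_ge hle] at *
    have aux : ∀ {φ : ℝ → E}, (∀ t ∈ I, HasDerivWithinAt φ (F (φ t)) I t) →
        ∀ s ∈ Ioc t t₀, HasDerivWithinAt φ (F (φ s)) (Iic s) s := fun hφ s hs =>
      ((hφ s (hsub (Ioc_subset_Icc_self hs))).mono hsub).mono_of_mem_nhdsWithin
        (Filter.mem_of_superset (Icc_mem_nhdsLE hs.1) (Icc_subset_Icc_right hs.2))
    exact ODE_solution_unique_of_mem_Icc_left (v := fun _ => F)
      (s := fun _ => closedBall 0 R) (fun _ _ => hK) hfc (aux hf)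
      (fun s hs => hfR s (Ioc_subset_Icc_self hs)) hgc (aux hg)
      (fun s hs => hgR s (Ioc_subset_Icc_self hs)) h ⟨le_rfl, hle⟩

/-- A locally Lipschitz field has a solution on `[t₀ - T, t₀ + T]` if the solutions of all its
scalings by time-dependent factors in `[0, 1]` are bounded a priori. -/
theorem LocallyLipschitz.exists_hasDerivWithinAt_Icc [FiniteDimensional ℝ E] {F : E → E}
    (hF : LocallyLipschitz F) (t₀ : ℝ) (x₀ : E) {T : ℝ} (hT : 0 ≤ T) (R : ℝ)
    (hR : ∀ (c : ℝ → ℝ) (γ : ℝ → E), (∀ t, c t ∈ Icc (0 : ℝ) 1) → γ t₀ = x₀ →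
      (∀ t ∈ Icc (t₀ - T) (t₀ + T),
        HasDerivWithinAt γ (c t • F (γ t)) (Icc (t₀ - T) (t₀ + T)) t) →
      ∀ t ∈ Icc (t₀ - T) (t₀ + T), ‖γ t‖ ≤ R) :
    ∃ γ : ℝ → E, γ t₀ = x₀ ∧ ∀ t ∈ Icc (t₀ - T) (t₀ + T),
      HasDerivWithinAt γ (F (γ t)) (Icc (t₀ - T) (t₀ + T)) t := by
  have : ProperSpace E := FiniteDimensional.proper ℝ E
  -- Cutoff equal to 1 on the ball of radius `R` and 0 outside radius `R + 1`; the truncated field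
  -- is bounded.
  set χ : E → ℝ := fun x => max 0 (min 1 (R + 1 - ‖x‖)) with hχ
  have hχ01 : ∀ x, χ x ∈ Icc (0 : ℝ) 1 := fun x =>
    ⟨le_max_left _ _, max_le zero_le_one (min_le_left _ _)⟩
  have hχ1 : ∀ x, ‖x‖ ≤ R → χ x = 1 := fun x hx => by
    simp only [hχ]
    rw [min_eq_left (by linarith), max_eq_right zero_le_one]
  have hχ0 : ∀ x, R + 1 ≤ ‖x‖ → χ x = 0 := fun x hx => by
    simp only [hχ]
    exact max_eq_left ((min_le_right _ _).trans (by linarith))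
  have hχL : LocallyLipschitz χ := by
    have h1 : LocallyLipschitz fun x : E => R + 1 - ‖x‖ :=
      ((LipschitzWith.const (R + 1)).sub lipschitzWith_one_norm).locallyLipschitz
    exact (h1.const_min 1).const_max 0
  set G : E → E := fun x => χ x • F x with hG
  have hGL : LocallyLipschitz G :=
    (contDiff_smul (𝕜 := ℝ) (F := E) (n := 1)).locallyLipschitz.comp (hχL.prodMk hF)
  have hGs : HasCompactSupport G := by
    refine HasCompactSupport.intro (isCompact_closedBall (0 : E) (R + 1)) (fun x hx => ?_)
    simp only [mem_closedBall, dist_zero_right, not_le] at hx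
    simp [hG, hχ0 x hx.le]
  obtain ⟨L, hL⟩ := hGs.exists_bound_of_continuous hGL.continuous
  have hL0 : 0 ≤ L := (norm_nonneg _).trans (hL 0)
  -- With speed at most `L`, the curve stays within `L * T` of `x₀` for time `T`, so Picard–Lindelöf
  -- covers the whole interval at once.
  obtain ⟨K, hK⟩ := hGL.exists_lipschitzOnWith_closedBall x₀ (L * T)
  have hpl : IsPicardLindelof (fun _ => G) (tmin := t₀ - T) (tmax := t₀ + T)
      ⟨t₀, by constructor <;> linarith⟩ x₀ ⟨L * T, by positivity⟩ 0 ⟨L, hL0⟩ K :=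
    { lipschitzOnWith := fun _ _ => hK
      continuousOn := fun _ _ => continuousOn_const
      norm_le := fun _ _ x _ => hL x
      mul_max_le := by simp; exact le_rfl }
  obtain ⟨γ, hγ0, hγ⟩ := hpl.exists_eq_forall_mem_Icc_hasDerivWithinAt₀
  refine ⟨γ, hγ0, fun t ht => ?_⟩
  -- The truncated solution is a scaled solution with factor `χ (γ t)`, so the a priori bound keeps
  -- it where the cutoff is inactive.
  have h1 : χ (γ t) = 1 :=
    hχ1 _ (hR (fun t => χ (γ t)) γ (fun t => hχ01 _) hγ0 hγ t ht)
  have h2 : HasDerivWithinAt γ (χ (γ t) • F (γ t)) (Icc (t₀ - T) (t₀ + T)) t := hγ t ht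
  rwa [h1, one_smul] at h2

theorem LocallyLipschitz.exists_hasDerivAt_of_apriori_bound [FiniteDimensional ℝ E] {F : E → E}
    (hF : LocallyLipschitz F) (t₀ : ℝ) (x₀ : E)
    (hR : ∀ T : ℝ, 0 ≤ T → ∃ R : ℝ, ∀ (c : ℝ → ℝ) (γ : ℝ → E), (∀ t, c t ∈ Icc (0 : ℝ) 1) →
      γ t₀ = x₀ → (∀ t ∈ Icc (t₀ - T) (t₀ + T),
        HasDerivWithinAt γ (c t • F (γ t)) (Icc (t₀ - T) (t₀ + T)) t) →
      ∀ t ∈ Icc (t₀ - T) (t₀ + T), ‖γ t‖ ≤ R) :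
    ∃ γ : ℝ → E, γ t₀ = x₀ ∧ ∀ t, HasDerivAt γ (F (γ t)) t := by
  have : ProperSpace E := FiniteDimensional.proper ℝ E
  have hex : ∀ n : ℕ, ∃ γ : ℝ → E, γ t₀ = x₀ ∧ ∀ t ∈ Icc (t₀ - n) (t₀ + n),
      HasDerivWithinAt γ (F (γ t)) (Icc (t₀ - n) (t₀ + n)) t := fun n => by
    obtain ⟨R, h⟩ := hR n n.cast_nonneg
    exact hF.exists_hasDerivWithinAt_Icc t₀ x₀ n.cast_nonneg R h
  choose γ hγ0 hγ using hex
  have hmono : ∀ {m n : ℕ}, m ≤ n → Icc (t₀ - m) (t₀ + m) ⊆ Icc (t₀ - n) (t₀ + n) := by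
    intro m n h
    have : (m : ℝ) ≤ n := by exact_mod_cast h
    exact Icc_subset_Icc (by linarith) (by linarith)
  have hcompat : ∀ {m n : ℕ}, m ≤ n → EqOn (γ m) (γ n) (Icc (t₀ - m) (t₀ + m)) := by
    intro m n h
    exact hF.eqOn_of_hasDerivWithinAt ordConnected_Icc
      ⟨by simp, by simp⟩ (hγ m)
      (fun t ht => (hγ n t (hmono h ht)).mono (hmono h)) ((hγ0 m).trans (hγ0 n).symm)
  have hmem : ∀ t, t ∈ Icc (t₀ - ⌈|t - t₀|⌉₊) (t₀ + ⌈|t - t₀|⌉₊) := fun t => by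
    have h1 := abs_le.1 (Nat.le_ceil |t - t₀|)
    constructor <;> linarith
  -- The solutions on growing intervals agree by uniqueness; at each time the first one that covers
  -- it is used.
  refine ⟨fun t => γ ⌈|t - t₀|⌉₊ t, hγ0 _, fun t => ?_⟩
  have heq : ∀ (n : ℕ), ∀ s ∈ Icc (t₀ - n) (t₀ + n), γ ⌈|s - t₀|⌉₊ s = γ n s := by
    intro n s hs
    rcases le_total ⌈|s - t₀|⌉₊ n with h | h
    · exact hcompat h (hmem s)
    · exact (hcompat h hs).symm
  -- The extra 1 places `t` in the interior of the interval.
  set N := ⌈|t - t₀|⌉₊ + 1 with hN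
  have hnhds : Icc (t₀ - N) (t₀ + N) ∈ 𝓝 t := by
    have h1 := hmem t
    apply Icc_mem_nhds
    · push_cast [hN]; linarith [h1.1]
    · push_cast [hN]; linarith [h1.2]
  have h2 := (hγ N t (mem_of_mem_nhds hnhds)).hasDerivAt hnhds
  rw [← heq N t (mem_of_mem_nhds hnhds)] at h2
  exact h2.congr_of_eventuallyEq (Filter.mem_of_superset hnhds (heq N))

end ODE


/-! ### Bounds for sums of peakons and sign identities -/

theorem abs_exp_neg_sub_exp_neg_le {a b : ℝ} (ha : 0 ≤ a) (hb : 0 ≤ b) :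
    |Real.exp (-a) - Real.exp (-b)| ≤ |a - b| := by
  wlog h : a ≤ b generalizing a b
  · rw [abs_sub_comm, abs_sub_comm a]
    exact this hb ha (le_of_not_ge h)
  have h1 := Real.add_one_le_exp (-(b - a))
  have h2 : Real.exp (-b) = Real.exp (-a) * Real.exp (-(b - a)) := by
    rw [← Real.exp_add]; ring_nf
  have h3 : Real.exp (-a) ≤ 1 := Real.exp_le_one_iff.2 (by linarith)
  have h4 : Real.exp (-b) ≤ Real.exp (-a) := Real.exp_le_exp.2 (by linarith)
  rw [abs_of_nonneg (by linarith), abs_of_nonpos (by linarith), h2]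
  nlinarith [Real.exp_pos (-a)]

theorem abs_sign_le_one (r : ℝ) : |Real.sign r| ≤ 1 := by
  rcases Real.sign_apply_eq r with h | h | h <;> simp [h]

section peakonSum

variable {N : ℕ}

theorem abs_sum_mul_le (a b : Fin N → ℝ) (hb : ∀ i, |b i| ≤ 1) :
    |∑ i, a i * b i| ≤ ∑ i, |a i| := by
  refine (Finset.abs_sum_le_sum_abs _ _).trans (Finset.sum_le_sum fun i _ => ?_)
  rw [abs_mul]
  exact mul_le_of_le_one_right (abs_nonneg _) (hb i)

theorem abs_peakonSum_le (a c : Fin N → ℝ) (z : ℝ) : |peakonSum a c z| ≤ ∑ i, |a i| :=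
  abs_sum_mul_le _ _ fun i => by
    rw [abs_of_pos (Real.exp_pos _)]
    exact Real.exp_le_one_iff.2 (neg_nonpos.2 (abs_nonneg _))

theorem abs_peakonSum_sub_le (a c : Fin N → ℝ) (z w : ℝ) :
    |peakonSum a c z - peakonSum a c w| ≤ (∑ i, |a i|) * |z - w| := by
  rw [peakonSum, peakonSum, ← Finset.sum_sub_distrib, Finset.sum_mul]
  refine (Finset.abs_sum_le_sum_abs _ _).trans (Finset.sum_le_sum fun i _ => ?_)
  rw [← mul_sub, abs_mul]
  refine mul_le_mul_of_nonneg_left ?_ (abs_nonneg _)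
  refine (abs_exp_neg_sub_exp_neg_le (abs_nonneg _) (abs_nonneg _)).trans ?_
  refine (abs_abs_sub_abs_le_abs_sub _ _).trans (le_of_eq ?_)
  congr 1; ring

theorem abs_signed_peakonSum_le (a c s : Fin N → ℝ) (hs : ∀ i, |s i| ≤ 1) (z : ℝ) :
    |∑ i, a i * s i * Real.exp (-|z - c i|)| ≤ peakonSum (fun i => |a i|) c z := by
  refine (Finset.abs_sum_le_sum_abs _ _).trans (Finset.sum_le_sum fun i _ => ?_)
  rw [abs_mul, abs_mul, abs_of_pos (Real.exp_pos _)]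
  exact mul_le_mul_of_nonneg_right (mul_le_of_le_one_right (abs_nonneg _) (hs i))
    (Real.exp_pos _).le

theorem peakonSum_nonneg {a : Fin N → ℝ} (ha : ∀ i, 0 ≤ a i) (c : Fin N → ℝ) (z : ℝ) :
    0 ≤ peakonSum a c z :=
  Finset.sum_nonneg fun i _ => mul_nonneg (ha i) (Real.exp_pos _).le

theorem sum_mul_mul_sign_sub_eq_zero (μ x : Fin N → ℝ) :
    ∑ i, ∑ j, μ i * (μ j * Real.sign (x i - x j)) = 0 := by
  have h : ∑ i, ∑ j, μ i * (μ j * Real.sign (x i - x j)) =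
      -∑ i, ∑ j, μ i * (μ j * Real.sign (x i - x j)) := by
    conv_rhs => rw [Finset.sum_comm]
    simp only [← Finset.sum_neg_distrib]
    refine Finset.sum_congr rfl fun i _ => Finset.sum_congr rfl fun j _ => ?_
    rw [← neg_sub (x i), Real.sign_neg]
    ring
  linarith

end peakonSum

/-- The sign difference vanishes unless `z` lies between `x` and `y` (end points allowed), and there
`|z - x| + |z - y| = |x - y|`. -/
theorem exp_mul_exp_mul_sign_sub_sign (z x y : ℝ) :
    Real.exp (-|z - x|) * Real.exp (-|z - y|) * (Real.sign (z - x) - Real.sign (z - y)) =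
      Real.exp (-|x - y|) * (Real.sign (z - x) - Real.sign (z - y)) := by
  by_cases h : Real.sign (z - x) = Real.sign (z - y)
  · rw [h]; ring
  congr 1
  rw [← Real.exp_add]
  congr 1
  rcases lt_trichotomy z x with hx | rfl | hx <;> rcases lt_trichotomy z y with hy | rfl | hy
  · exact absurd ((Real.sign_of_neg (sub_neg.2 hx)).trans
      (Real.sign_of_neg (sub_neg.2 hy)).symm) h
  · simp [abs_sub_comm]
  · rw [abs_of_neg (sub_neg.2 hx), abs_of_pos (sub_pos.2 hy), abs_of_pos (by linarith)]; ring
  · simp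
  · simp
  · simp
  · rw [abs_of_pos (sub_pos.2 hx), abs_of_neg (sub_neg.2 hy), abs_of_neg (by linarith)]; ring
  · simp [abs_sub_comm]
  · exact absurd ((Real.sign_of_pos (sub_pos.2 hx)).trans
      (Real.sign_of_pos (sub_pos.2 hy)).symm) h

/-! ### Prescribed signs, velocity estimates and the conserved energy -/

namespace PeakonConfig

variable {N₁ N₂ : ℕ}

/-- The amplitudes of all `N₁ + N₂` peakons together. -/
def amp (p : PeakonConfig N₁ N₂) : Fin N₁ ⊕ Fin N₂ → ℝ := Sum.elim p.m p.n

/-- The signs of the differences of positions. -/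
noncomputable def sgn (p : PeakonConfig N₁ N₂) (a b : Fin N₁ ⊕ Fin N₂) : ℝ :=
  Real.sign (p.pos a - p.pos b)

/-- The averaged derivative of `u` at the `a`-th peakon, with prescribed signs. -/
noncomputable def signedUx (s : Fin N₁ ⊕ Fin N₂ → Fin N₁ ⊕ Fin N₂ → ℝ) (p : PeakonConfig N₁ N₂)
    (a : Fin N₁ ⊕ Fin N₂) : ℝ :=
  -∑ i, p.m i * s a (Sum.inl i) * Real.exp (-|p.pos a - p.x i|)

/-- The averaged derivative of `v` at the `a`-th peakon, with prescribed signs. -/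
noncomputable def signedVx (s : Fin N₁ ⊕ Fin N₂ → Fin N₁ ⊕ Fin N₂ → ℝ) (p : PeakonConfig N₁ N₂)
    (a : Fin N₁ ⊕ Fin N₂) : ℝ :=
  -∑ j, p.n j * s a (Sum.inr j) * Real.exp (-|p.pos a - p.y j|)

/-- The logarithmic derivatives of the amplitudes, with prescribed signs. -/
noncomputable def rate (s : Fin N₁ ⊕ Fin N₂ → Fin N₁ ⊕ Fin N₂ → ℝ) (p : PeakonConfig N₁ N₂) :
    Fin N₁ ⊕ Fin N₂ → ℝ
  | Sum.inl k => p.u (p.x k) * p.signedVx s (Sum.inl k)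
      - 2 * p.signedUx s (Sum.inl k) * p.v (p.x k)
  | Sum.inr k => p.signedUx s (Sum.inr k) * p.v (p.y k)
      - 2 * p.u (p.y k) * p.signedVx s (Sum.inr k)

/-- The Geng–Xue peakon ODEs with prescribed signs `s` and time scaled by the factor `c`. -/
structure IsScaledSolutionOn (c : ℝ → ℝ) (s : ℝ → Fin N₁ ⊕ Fin N₂ → Fin N₁ ⊕ Fin N₂ → ℝ)
    (p : ℝ → PeakonConfig N₁ N₂) (J : Set ℝ) : Prop where
  pos_ode : ∀ t ∈ J, ∀ a, HasDerivWithinAt (fun r => (p r).pos a)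
    (c t * ((p t).u ((p t).pos a) * (p t).v ((p t).pos a))) J t
  amp_ode : ∀ t ∈ J, ∀ a, HasDerivWithinAt (fun r => (p r).amp a)
    (c t * ((p t).amp a * (p t).rate (s t) a)) J t

theorem isPeakonSolutionOn_iff {p : ℝ → PeakonConfig N₁ N₂} {I : Set ℝ} :
    IsPeakonSolutionOn p I ↔ IsScaledSolutionOn 1 (fun t => (p t).sgn) p I := by
  constructor
  · intro h
    constructor
    · rintro t ht (k | k)
      · exact (h.x_ode t ht k).congr_deriv (one_mul _).symm
      · exact (h.y_ode t ht k).congr_deriv (one_mul _).symm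
    · rintro t ht (k | k)
      · exact (h.m_ode t ht k).congr_deriv (one_mul _).symm
      · exact (h.n_ode t ht k).congr_deriv (one_mul _).symm
  · intro h
    constructor
    · intro t ht k
      exact (h.pos_ode t ht (Sum.inl k)).congr_deriv (one_mul _)
    · intro t ht k
      exact (h.pos_ode t ht (Sum.inr k)).congr_deriv (one_mul _)
    · intro t ht k
      exact (h.amp_ode t ht (Sum.inl k)).congr_deriv (one_mul _)
    · intro t ht k
      exact (h.amp_ode t ht (Sum.inr k)).congr_deriv (one_mul _)

theorem IsScaledSolutionOn.mono {c : ℝ → ℝ} {s : ℝ → Fin N₁ ⊕ Fin N₂ → Fin N₁ ⊕ Fin N₂ → ℝ}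
    {p : ℝ → PeakonConfig N₁ N₂} {I J : Set ℝ} (h : IsScaledSolutionOn c s p J) (hIJ : I ⊆ J) :
    IsScaledSolutionOn c s p I :=
  ⟨fun t ht a => (h.pos_ode t (hIJ ht) a).mono hIJ,
    fun t ht a => (h.amp_ode t (hIJ ht) a).mono hIJ⟩

/-! ### Estimates -/

/-- The peakon sums are kept in the bound, instead of total amplitudes, because for positive
amplitudes their product is `u * v`, which the energy controls. -/
theorem abs_rate_le {s : Fin N₁ ⊕ Fin N₂ → Fin N₁ ⊕ Fin N₂ → ℝ} (hs : ∀ a b, |s a b| ≤ 1)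
    (p : PeakonConfig N₁ N₂) (a : Fin N₁ ⊕ Fin N₂) :
    |p.rate s a| ≤ 3 * (peakonSum (fun i => |p.m i|) p.x (p.pos a) *
      peakonSum (fun j => |p.n j|) p.y (p.pos a)) := by
  have abs_u : ∀ z, |p.u z| ≤ peakonSum (fun i => |p.m i|) p.x z := fun z => by
    simpa [u, peakonSum] using abs_signed_peakonSum_le p.m p.x 1 (by simp) z
  have abs_v : ∀ z, |p.v z| ≤ peakonSum (fun j => |p.n j|) p.y z := fun z => by
    simpa [v, peakonSum] using abs_signed_peakonSum_le p.n p.y 1 (by simp) z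
  have abs_ux : |p.signedUx s a| ≤ peakonSum (fun i => |p.m i|) p.x (p.pos a) := by
    rw [signedUx, abs_neg]
    exact abs_signed_peakonSum_le p.m p.x (fun i => s a (Sum.inl i)) (fun i => hs _ _) _
  have abs_vx : |p.signedVx s a| ≤ peakonSum (fun j => |p.n j|) p.y (p.pos a) := by
    rw [signedVx, abs_neg]
    exact abs_signed_peakonSum_le p.n p.y (fun i => s a (Sum.inr i)) (fun i => hs _ _) _
  have h1 : ∀ {α β U V : ℝ}, |α| ≤ U → |β| ≤ V → |α * β| ≤ U * V := fun ha hb => by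
    rw [abs_mul]
    exact mul_le_mul ha hb (abs_nonneg _) ((abs_nonneg _).trans ha)
  have h2 : ∀ {α β W : ℝ}, |α| ≤ W → |β| ≤ W → |α - 2 * β| ≤ 3 * W := fun ha hb => by
    have := abs_le.1 ha
    have := abs_le.1 hb
    exact abs_le.2 ⟨by linarith, by linarith⟩
  rcases a with k | k
  · have := h2 (h1 (abs_u (p.x k)) abs_vx) (h1 abs_ux (abs_v (p.x k)))
    simpa [rate, mul_assoc, pos] using this
  · have := h2 (h1 abs_ux (abs_v (p.y k))) (h1 (abs_u (p.y k)) abs_vx)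
    simpa [rate, mul_assoc, pos] using this

theorem abs_velocity_sub_le (p : PeakonConfig N₁ N₂) (z w : ℝ) :
    |p.u z * p.v z - p.u w * p.v w| ≤
      2 * ((∑ i, |p.m i|) * ∑ j, |p.n j|) * |z - w| := by
  have hu := abs_peakonSum_le p.m p.x z
  have hv := abs_peakonSum_le p.n p.y w
  have hu' := abs_peakonSum_sub_le p.m p.x z w
  have hv' := abs_peakonSum_sub_le p.n p.y z w
  have hm : 0 ≤ ∑ i, |p.m i| := (abs_nonneg _).trans hu
  have hn : 0 ≤ ∑ i, |p.n i| := (abs_nonneg _).trans hv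
  calc |p.u z * p.v z - p.u w * p.v w|
      = |p.u z * (p.v z - p.v w) + (p.u z - p.u w) * p.v w| := by congr 1; ring
    _ ≤ |p.u z| * |p.v z - p.v w| + |p.u z - p.u w| * |p.v w| := by
        rw [← abs_mul, ← abs_mul]; exact abs_add_le _ _
    _ ≤ (∑ i, |p.m i|) * ((∑ j, |p.n j|) * |z - w|) +
          ((∑ i, |p.m i|) * |z - w|) * ∑ j, |p.n j| := by
        refine add_le_add (mul_le_mul hu hv' (abs_nonneg _) hm)
          (mul_le_mul hu' hv (abs_nonneg _) (by positivity))
    _ = _ := by ring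

/-- The conserved quantity `∑ i, ∑ j, m i * n j * exp (-|x i - y j|)`. -/
noncomputable def energy (p : PeakonConfig N₁ N₂) : ℝ :=
  ∑ i, ∑ j, p.m i * p.n j * Real.exp (-|p.x i - p.y j|)

/-- Termwise, this is the triangle inequality for `x i`, `z`, `y j`. -/
theorem u_mul_v_le_energy (p : PeakonConfig N₁ N₂) (hm : ∀ i, 0 ≤ p.m i) (hn : ∀ j, 0 ≤ p.n j)
    (z : ℝ) : p.u z * p.v z ≤ p.energy := by
  rw [u, v, peakonSum, peakonSum, Finset.sum_mul_sum]
  refine Finset.sum_le_sum fun i _ => Finset.sum_le_sum fun j _ => ?_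
  rw [mul_mul_mul_comm, ← Real.exp_add]
  refine mul_le_mul_of_nonneg_left (Real.exp_le_exp.2 ?_) (mul_nonneg (hm i) (hn j))
  have := abs_sub_le (p.x i) z (p.y j)
  rw [abs_sub_comm (p.x i) z] at this
  linarith

theorem wronskian_eq (p : PeakonConfig N₁ N₂) (z : ℝ) :
    p.u z * p.vx z - p.ux z * p.v z =
      (∑ i, p.m i * p.v (p.x i) * Real.sign (z - p.x i)) -
        ∑ j, p.n j * p.u (p.y j) * Real.sign (z - p.y j) := by
  have hL : p.u z * p.vx z - p.ux z * p.v z = ∑ i, ∑ j, p.m i * p.n j *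
      (Real.exp (-|z - p.x i|) * Real.exp (-|z - p.y j|) *
        (Real.sign (z - p.x i) - Real.sign (z - p.y j))) := by
    simp only [u, v, ux, vx, peakonSum, peakonSumDeriv, mul_neg, neg_mul, Finset.sum_mul_sum,
      ← Finset.sum_neg_distrib, ← Finset.sum_sub_distrib]
    refine Finset.sum_congr rfl fun i _ => Finset.sum_congr rfl fun j _ => ?_
    ring
  have h1 : ∑ i, p.m i * p.v (p.x i) * Real.sign (z - p.x i) = ∑ i, ∑ j, p.m i * p.n j *
      (Real.exp (-|p.x i - p.y j|) * Real.sign (z - p.x i)) := by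
    simp only [v, peakonSum, Finset.mul_sum, Finset.sum_mul]
    refine Finset.sum_congr rfl fun i _ => Finset.sum_congr rfl fun j _ => ?_
    ring
  have h2 : ∑ j, p.n j * p.u (p.y j) * Real.sign (z - p.y j) = ∑ i, ∑ j, p.m i * p.n j *
      (Real.exp (-|p.x i - p.y j|) * Real.sign (z - p.y j)) := by
    rw [Finset.sum_comm]
    simp only [u, peakonSum, Finset.mul_sum, Finset.sum_mul]
    refine Finset.sum_congr rfl fun i _ => Finset.sum_congr rfl fun j _ => ?_
    rw [abs_sub_comm]
    ring
  rw [hL, h1, h2]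
  simp only [← Finset.sum_sub_distrib]
  refine Finset.sum_congr rfl fun i _ => Finset.sum_congr rfl fun j _ => ?_
  rw [exp_mul_exp_mul_sign_sub_sign]
  ring

/-- Put `μ i = m i * v (x i)` and `ν j = n j * u (y j)`. After `wronskian_eq`, the `μμ` and `νν`
terms cancel by oddness of the sign, and both sides become the same `μν` double sum. -/
theorem sum_wronskian_eq (p : PeakonConfig N₁ N₂) :
    ∑ i, p.m i * p.v (p.x i) * (p.u (p.x i) * p.vx (p.x i) - p.ux (p.x i) * p.v (p.x i)) =
      ∑ j, p.n j * p.u (p.y j) *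
        (p.u (p.y j) * p.vx (p.y j) - p.ux (p.y j) * p.v (p.y j)) := by
  simp only [wronskian_eq, mul_sub, Finset.sum_sub_distrib]
  generalize hμ : (fun i => p.m i * p.v (p.x i)) = μ
  generalize hν : (fun j => p.n j * p.u (p.y j)) = ν
  simp only [funext_iff] at hμ hν
  simp only [hμ, hν, Finset.mul_sum, sum_mul_mul_sign_sub_eq_zero, zero_sub, sub_zero]
  rw [Finset.sum_comm, ← Finset.sum_neg_distrib]
  refine Finset.sum_congr rfl fun j _ => ?_
  rw [← Finset.sum_neg_distrib]
  refine Finset.sum_congr rfl fun i _ => ?_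
  rw [← neg_sub (p.y j), Real.sign_neg]
  ring

/-- The terms from the motion of the `u`-peakons (`h1`) and of the `v`-peakons (`h2`) give twice the
two sides of `sum_wronskian_eq`, with opposite signs. -/
theorem energy_deriv_eq_zero (p : PeakonConfig N₁ N₂) :
    ∑ i, ∑ j, ((p.m i * p.rate p.sgn (Sum.inl i) * p.n j +
        p.m i * (p.n j * p.rate p.sgn (Sum.inr j))) * Real.exp (-|p.x i - p.y j|) +
      p.m i * p.n j * (Real.exp (-|p.x i - p.y j|) * -(Real.sign (p.x i - p.y j) *
        (p.u (p.x i) * p.v (p.x i) - p.u (p.y j) * p.v (p.y j))))) = 0 := by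
  have h1 : ∑ i, ∑ j, (p.m i * p.rate p.sgn (Sum.inl i) * p.n j * Real.exp (-|p.x i - p.y j|) -
      p.m i * p.n j * (Real.exp (-|p.x i - p.y j|) * (Real.sign (p.x i - p.y j) *
        (p.u (p.x i) * p.v (p.x i))))) = 2 * ∑ i, p.m i * p.v (p.x i) *
          (p.u (p.x i) * p.vx (p.x i) - p.ux (p.x i) * p.v (p.x i)) := by
    rw [Finset.mul_sum]
    refine Finset.sum_congr rfl fun i _ => ?_
    have hr : p.rate p.sgn (Sum.inl i) =
      p.u (p.x i) * p.vx (p.x i) - 2 * p.ux (p.x i) * p.v (p.x i) := rfl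
    have : ∑ j, (p.m i * p.rate p.sgn (Sum.inl i) * p.n j * Real.exp (-|p.x i - p.y j|) -
      p.m i * p.n j * (Real.exp (-|p.x i - p.y j|) * (Real.sign (p.x i - p.y j) *
        (p.u (p.x i) * p.v (p.x i))))) = p.m i * p.rate p.sgn (Sum.inl i) * p.v (p.x i) +
          p.m i * (p.u (p.x i) * p.v (p.x i)) * p.vx (p.x i) := by
      conv_rhs => rw [v, vx, peakonSum, peakonSumDeriv, mul_neg, Finset.mul_sum, Finset.mul_sum,
        ← sub_eq_add_neg, ← Finset.sum_sub_distrib]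
      refine Finset.sum_congr rfl fun j _ => ?_
      rw [v, peakonSum]
      ring
    rw [this, hr]
    ring
  have h2 : ∑ i, ∑ j, (p.m i * (p.n j * p.rate p.sgn (Sum.inr j)) * Real.exp (-|p.x i - p.y j|) +
      p.m i * p.n j * (Real.exp (-|p.x i - p.y j|) * (Real.sign (p.x i - p.y j) *
        (p.u (p.y j) * p.v (p.y j))))) = -(2 * ∑ j, p.n j * p.u (p.y j) *
          (p.u (p.y j) * p.vx (p.y j) - p.ux (p.y j) * p.v (p.y j))) := by
    rw [Finset.mul_sum, Finset.sum_comm, ← Finset.sum_neg_distrib]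
    refine Finset.sum_congr rfl fun j _ => ?_
    have hr : p.rate p.sgn (Sum.inr j) =
      p.ux (p.y j) * p.v (p.y j) - 2 * p.u (p.y j) * p.vx (p.y j) := rfl
    have : ∑ i, (p.m i * (p.n j * p.rate p.sgn (Sum.inr j)) * Real.exp (-|p.x i - p.y j|) +
      p.m i * p.n j * (Real.exp (-|p.x i - p.y j|) * (Real.sign (p.x i - p.y j) *
        (p.u (p.y j) * p.v (p.y j))))) = p.n j * p.rate p.sgn (Sum.inr j) * p.u (p.y j) +
          p.n j * (p.u (p.y j) * p.v (p.y j)) * p.ux (p.y j) := by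
      conv_rhs => rw [u, ux, peakonSum, peakonSumDeriv, mul_neg, Finset.mul_sum, Finset.mul_sum,
        ← sub_eq_add_neg, ← Finset.sum_sub_distrib]
      refine Finset.sum_congr rfl fun i _ => ?_
      rw [u, peakonSum, ← neg_sub (p.y j) (p.x i), abs_neg, Real.sign_neg]
      ring
    rw [this, hr]
    ring
  have h3 := p.sum_wronskian_eq
  rw [← sub_eq_zero, ← mul_eq_zero_iff_left (two_ne_zero' ℝ), mul_sub, sub_eq_add_neg, ← h1, ← h2,
    ← Finset.sum_add_distrib] at h3
  rw [← h3]
  refine Finset.sum_congr rfl fun i _ => ?_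
  rw [← Finset.sum_add_distrib]
  refine Finset.sum_congr rfl fun j _ => ?_
  ring

end PeakonConfig


/-! ### Preservation of order and positivity; global bounds -/

namespace PeakonConfig

variable {N₁ N₂ : ℕ}

theorem abs_sgn_le_one (p : PeakonConfig N₁ N₂) (a b : Fin N₁ ⊕ Fin N₂) : |p.sgn a b| ≤ 1 :=
  abs_sign_le_one _

theorem SameOrder.sgn_eq {p q : PeakonConfig N₁ N₂} (h : p.SameOrder q) : p.sgn = q.sgn := by
  funext a b
  rcases lt_trichotomy (q.pos a) (q.pos b) with hlt | heq | hgt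
  · rw [sgn, sgn, Real.sign_of_neg (sub_neg.2 hlt), Real.sign_of_neg (sub_neg.2 ((h a b).2 hlt))]
  · have h1 : p.pos a = p.pos b := le_antisymm
      (not_lt.1 fun hlt => ((h b a).1 hlt).ne' heq) (not_lt.1 fun hlt => ((h a b).1 hlt).ne heq)
    rw [sgn, sgn, heq, h1, sub_self, sub_self]
  · rw [sgn, sgn, Real.sign_of_pos (sub_pos.2 hgt), Real.sign_of_pos (sub_pos.2 ((h b a).2 hgt))]

theorem IsPure.pos_injective {p : PeakonConfig N₁ N₂} (h : p.IsPure) : Function.Injective p.pos :=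
  Function.Injective.sumElim h.x_strictMono.injective h.y_strictMono.injective h.x_ne_y

theorem IsPure.amp_pos {p : PeakonConfig N₁ N₂} (h : p.IsPure) (a : Fin N₁ ⊕ Fin N₂) :
    0 < p.amp a := by
  rcases a with k | k
  · exact h.m_pos k
  · exact h.n_pos k

theorem IsPure.sameOrder_of_forall_lt {p q : PeakonConfig N₁ N₂} (hq : q.IsPure)
    (h : ∀ a b, q.pos a < q.pos b → p.pos a < p.pos b) : p.SameOrder q := by
  refine fun a b => ⟨fun hp => ?_, h a b⟩
  rcases lt_trichotomy (q.pos a) (q.pos b) with hlt | heq | hgt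
  · exact hlt
  · rw [hq.pos_injective heq] at hp
    exact absurd hp (lt_irrefl _)
  · exact absurd hp (h b a hgt).not_gt

theorem IsPure.of_sameOrder {p q : PeakonConfig N₁ N₂} (hq : q.IsPure) (h : p.SameOrder q)
    (hp : ∀ a, 0 < p.amp a) : p.IsPure where
  x_strictMono i j hij := (h (Sum.inl i) (Sum.inl j)).2 (hq.x_strictMono hij)
  y_strictMono i j hij := (h (Sum.inr i) (Sum.inr j)).2 (hq.y_strictMono hij)
  x_ne_y i j hij := by
    rcases lt_or_gt_of_ne (hq.x_ne_y i j) with h1 | h1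
    · exact ((h (Sum.inl i) (Sum.inr j)).2 h1).ne hij
    · exact ((h (Sum.inr j) (Sum.inl i)).2 h1).ne' hij
  m_pos i := hp (Sum.inl i)
  n_pos j := hp (Sum.inr j)

/-! ### A priori estimates along solutions -/

namespace IsScaledSolutionOn

variable {c : ℝ → ℝ} {s : ℝ → Fin N₁ ⊕ Fin N₂ → Fin N₁ ⊕ Fin N₂ → ℝ}
  {p : ℝ → PeakonConfig N₁ N₂} {J : Set ℝ}

theorem exists_sum_abs_amp_le (h : IsScaledSolutionOn c s p J) (hJ : IsCompact J) :
    ∃ B, 0 ≤ B ∧ ∀ t ∈ J, (∑ i, |(p t).m i|) * (∑ j, |(p t).n j|) ≤ B := by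
  have hc : ContinuousOn (fun t => (∑ i, |(p t).m i|) * (∑ j, |(p t).n j|)) J := by
    refine (continuousOn_finsetSum _ fun i _ => ?_).mul (continuousOn_finsetSum _ fun j _ => ?_)
    · exact ContinuousOn.abs fun t ht => (h.amp_ode t ht (Sum.inl i)).continuousWithinAt
    · exact ContinuousOn.abs fun t ht => (h.amp_ode t ht (Sum.inr j)).continuousWithinAt
  obtain ⟨B, hB⟩ := hJ.exists_bound_of_continuousOn hc
  exact ⟨max B 0, le_max_right _ _, fun t ht =>
    (le_abs_self _).trans ((hB t ht).trans (le_max_left _ _))⟩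

/-- The signs `s` need not match the configuration, so this serves both genuine solutions and those
with frozen signs. The amplitude bound comes from compactness and may depend on the solution. -/
theorem isPure_and_sameOrder (h : IsScaledSolutionOn c s p J) (hJc : IsCompact J)
    (hJ : J.OrdConnected) (hc : ∀ t ∈ J, |c t| ≤ 1) (hs : ∀ t ∈ J, ∀ a b, |s t a b| ≤ 1)
    {t₀ : ℝ} (ht₀ : t₀ ∈ J) (h₀ : (p t₀).IsPure) {t : ℝ} (ht : t ∈ J) :
    (p t).IsPure ∧ (p t).SameOrder (p t₀) := by
  obtain ⟨B, hB0, hB⟩ := h.exists_sum_abs_amp_le hJc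
  have hamp : ∀ a, 0 < (p t).amp a := fun a => by
    refine pos_of_abs_deriv_le_mul_abs hJ (fun r hr => h.amp_ode r hr a) (C := 3 * B)
      (fun r hr => ?_) ht₀ ht (h₀.amp_pos a)
    have h1 : |(p r).rate (s r) a| ≤ 3 * B := by
      refine (abs_rate_le (hs r hr) _ a).trans (mul_le_mul_of_nonneg_left ?_ (by norm_num))
      refine le_trans (mul_le_mul ?_ ?_ (peakonSum_nonneg (fun _ => abs_nonneg _) _ _)
        (Finset.sum_nonneg fun _ _ => abs_nonneg _)) (hB r hr)
      · simpa using (le_abs_self _).trans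
          (abs_peakonSum_le (fun i => |(p r).m i|) (p r).x ((p r).pos a))
      · simpa using (le_abs_self _).trans
          (abs_peakonSum_le (fun i => |(p r).n i|) (p r).y ((p r).pos a))
    rw [abs_mul, abs_mul, mul_comm (3 * B)]
    exact (mul_le_of_le_one_left (by positivity) (hc r hr)).trans
      (mul_le_mul_of_nonneg_left h1 (abs_nonneg _))
  have hord : (p t).SameOrder (p t₀) := h₀.sameOrder_of_forall_lt fun a b hab => by
    rw [← sub_pos] at hab ⊢
    refine pos_of_abs_deriv_le_mul_abs hJ (f := fun r => (p r).pos b - (p r).pos a)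
      (fun r hr => (h.pos_ode r hr b).sub (h.pos_ode r hr a))
      (C := 2 * B) (fun r hr => ?_) ht₀ ht hab
    rw [← mul_sub, abs_mul]
    refine (mul_le_of_le_one_left (abs_nonneg _) (hc r hr)).trans
      ((abs_velocity_sub_le _ _ _).trans (mul_le_mul_of_nonneg_right ?_ (abs_nonneg _)))
    exact mul_le_mul_of_nonneg_left (hB r hr) (by norm_num)
  exact ⟨h₀.of_sameOrder hord hamp, hord⟩

/-- Conservation needs the true signs, and `hp` makes `|x i - y j|` differentiable. The time scaling
only multiplies the zero derivative by `c t`. -/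
theorem hasDerivWithinAt_energy (h : IsScaledSolutionOn c s p J) {t : ℝ} (ht : t ∈ J)
    (hs : s t = (p t).sgn) (hp : ∀ i j, (p t).x i ≠ (p t).y j) :
    HasDerivWithinAt (fun r => (p r).energy) 0 J t := by
  have hx : ∀ i, HasDerivWithinAt (fun r => (p r).x i) _ J t := fun i =>
    h.pos_ode t ht (Sum.inl i)
  have hy : ∀ j, HasDerivWithinAt (fun r => (p r).y j) _ J t := fun j =>
    h.pos_ode t ht (Sum.inr j)
  have hm : ∀ i, HasDerivWithinAt (fun r => (p r).m i) _ J t := fun i =>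
    h.amp_ode t ht (Sum.inl i)
  have hn : ∀ j, HasDerivWithinAt (fun r => (p r).n j) _ J t := fun j =>
    h.amp_ode t ht (Sum.inr j)
  have habs : ∀ {r : ℝ}, r ≠ 0 → HasDerivAt (fun r : ℝ => |r|) (Real.sign r) r := fun {r} hr => by
    rcases lt_or_gt_of_ne hr with h | h
    · rw [Real.sign_of_neg h]; exact hasDerivAt_abs_neg h
    · rw [Real.sign_of_pos h]; exact hasDerivAt_abs_pos h
  have hsum := HasDerivWithinAt.fun_sum (u := Finset.univ) fun i _ =>
    HasDerivWithinAt.fun_sum (u := Finset.univ) fun j _ => ((hm i).mul (hn j)).mul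
      ((habs (sub_ne_zero.2 (hp i j))).comp_hasDerivWithinAt t ((hx i).sub (hy j))).neg.exp
  refine hsum.congr_deriv ?_
  rw [← mul_zero (c t), ← (p t).energy_deriv_eq_zero, Finset.mul_sum]
  refine Finset.sum_congr rfl fun i _ => ?_
  rw [Finset.mul_sum]
  refine Finset.sum_congr rfl fun j _ => ?_
  simp only [hs, amp, pos, Sum.elim_inl, Sum.elim_inr, Pi.sub_apply, Pi.mul_apply, Pi.neg_apply,
    Function.comp_apply]
  ring

theorem energy_eq (h : IsScaledSolutionOn c s p J) (hJ : J.OrdConnected)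
    (hs : ∀ t ∈ J, s t = (p t).sgn) (hp : ∀ t ∈ J, (p t).IsPure) {t₀ t : ℝ} (ht₀ : t₀ ∈ J)
    (ht : t ∈ J) : (p t).energy = (p t₀).energy := by
  have hd := fun r (hr : r ∈ J) => h.hasDerivWithinAt_energy hr (hs r hr) (hp r hr).x_ne_y
  have := hJ.convex.norm_image_sub_le_of_norm_hasDerivWithin_le (C := 0) hd (by simp) ht₀ ht
  simpa [sub_eq_zero] using this

theorem abs_velocity_le (h : IsScaledSolutionOn c s p J) (hJ : J.OrdConnected)
    (hs : ∀ t ∈ J, s t = (p t).sgn) (hp : ∀ t ∈ J, (p t).IsPure) {t₀ t : ℝ} (ht₀ : t₀ ∈ J)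
    (ht : t ∈ J) (z : ℝ) : |(p t).u z * (p t).v z| ≤ (p t₀).energy := by
  have hm := fun i => ((hp t ht).m_pos i).le
  have hn := fun i => ((hp t ht).n_pos i).le
  have h0 : 0 ≤ (p t).u z * (p t).v z :=
    mul_nonneg (peakonSum_nonneg hm _ _) (peakonSum_nonneg hn _ _)
  rw [← h.energy_eq hJ hs hp ht₀ ht, abs_of_nonneg h0]
  exact u_mul_v_le_energy _ hm hn _

theorem abs_pos_le (h : IsScaledSolutionOn c s p J) (hJ : J.OrdConnected)
    (hc : ∀ t ∈ J, |c t| ≤ 1) (hs : ∀ t ∈ J, s t = (p t).sgn) (hp : ∀ t ∈ J, (p t).IsPure)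
    {t₀ t : ℝ} (ht₀ : t₀ ∈ J) (ht : t ∈ J) (a : Fin N₁ ⊕ Fin N₂) :
    |(p t).pos a| ≤ |(p t₀).pos a| + (p t₀).energy * |t - t₀| := by
  have := hJ.convex.norm_image_sub_le_of_norm_hasDerivWithin_le (C := (p t₀).energy)
    (fun r hr => h.pos_ode r hr a) (fun r hr => ?_) ht₀ ht
  · have h1 := abs_sub_abs_le_abs_sub ((p t).pos a) ((p t₀).pos a)
    simp only [Real.norm_eq_abs] at this
    linarith
  · rw [Real.norm_eq_abs, abs_mul]
    exact (mul_le_of_le_one_left (abs_nonneg _) (hc r hr)).trans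
      (h.abs_velocity_le hJ hs hp ht₀ hr _)

theorem abs_amp_le (h : IsScaledSolutionOn c s p J) (hJ : J.OrdConnected)
    (hc : ∀ t ∈ J, |c t| ≤ 1) (hs : ∀ t ∈ J, s t = (p t).sgn) (hp : ∀ t ∈ J, (p t).IsPure)
    {t₀ t : ℝ} (ht₀ : t₀ ∈ J) (ht : t ∈ J) (a : Fin N₁ ⊕ Fin N₂) :
    |(p t).amp a| ≤ |(p t₀).amp a| * Real.exp (3 * (p t₀).energy * |t₀ - t|) := by
  refine abs_le_abs_mul_exp_of_abs_deriv_le hJ (fun r hr => h.amp_ode r hr a) (fun r hr => ?_)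
    ht ht₀
  have h1 : |(p r).rate (s r) a| ≤ 3 * (p t₀).energy := by
    refine (abs_rate_le (fun a b => ?_) _ a).trans (mul_le_mul_of_nonneg_left ?_ (by norm_num))
    · rw [hs r hr]; exact abs_sgn_le_one _ _ _
    · simp only [fun i => abs_of_pos ((hp r hr).m_pos i), fun i => abs_of_pos ((hp r hr).n_pos i)]
      exact (le_abs_self _).trans (h.abs_velocity_le hJ hs hp ht₀ hr _)
  rw [abs_mul, abs_mul, mul_comm (3 * _)]
  exact (mul_le_of_le_one_left (by positivity) (hc r hr)).trans
    (mul_le_mul_of_nonneg_left h1 (abs_nonneg _))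

end IsScaledSolutionOn

/-! ### The vector field with prescribed signs -/

/-- The configuration with given positions and amplitudes. -/
def ofPair (P : (Fin N₁ ⊕ Fin N₂ → ℝ) × (Fin N₁ ⊕ Fin N₂ → ℝ)) : PeakonConfig N₁ N₂ :=
  ⟨fun i => P.1 (Sum.inl i), fun j => P.1 (Sum.inr j), fun i => P.2 (Sum.inl i),
    fun j => P.2 (Sum.inr j)⟩

/-- The positions and the amplitudes of a configuration. -/
def toPair (p : PeakonConfig N₁ N₂) : (Fin N₁ ⊕ Fin N₂ → ℝ) × (Fin N₁ ⊕ Fin N₂ → ℝ) :=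
  (p.pos, p.amp)

theorem ofPair_toPair (p : PeakonConfig N₁ N₂) : ofPair p.toPair = p := rfl

theorem pos_ofPair (P : (Fin N₁ ⊕ Fin N₂ → ℝ) × (Fin N₁ ⊕ Fin N₂ → ℝ)) : (ofPair P).pos = P.1 := by
  funext a; cases a <;> rfl

theorem amp_ofPair (P : (Fin N₁ ⊕ Fin N₂ → ℝ) × (Fin N₁ ⊕ Fin N₂ → ℝ)) : (ofPair P).amp = P.2 := by
  funext a; cases a <;> rfl

/-- The vector field of the Geng–Xue peakon ODEs with prescribed signs. -/
noncomputable def field (s : Fin N₁ ⊕ Fin N₂ → Fin N₁ ⊕ Fin N₂ → ℝ)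
    (P : (Fin N₁ ⊕ Fin N₂ → ℝ) × (Fin N₁ ⊕ Fin N₂ → ℝ)) :
    (Fin N₁ ⊕ Fin N₂ → ℝ) × (Fin N₁ ⊕ Fin N₂ → ℝ) :=
  (fun a => (ofPair P).u ((ofPair P).pos a) * (ofPair P).v ((ofPair P).pos a),
    fun a => (ofPair P).amp a * (ofPair P).rate s a)

theorem isScaledSolutionOn_iff {c : ℝ → ℝ} {s : Fin N₁ ⊕ Fin N₂ → Fin N₁ ⊕ Fin N₂ → ℝ}
    {p : ℝ → PeakonConfig N₁ N₂} {J : Set ℝ} :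
    IsScaledSolutionOn c (fun _ => s) p J ↔ ∀ t ∈ J,
      HasDerivWithinAt (fun t => (p t).toPair) (c t • field s (p t).toPair) J t := by
  constructor
  · intro h t ht
    exact HasDerivWithinAt.prodMk (hasDerivWithinAt_pi.2 (h.pos_ode t ht))
      (hasDerivWithinAt_pi.2 (h.amp_ode t ht))
  · intro h
    exact ⟨fun t ht => hasDerivWithinAt_pi.1 (h t ht).fst,
      fun t ht => hasDerivWithinAt_pi.1 (h t ht).snd⟩

/-- With constant signs the field is a smooth function `S` of the amplitudes and the pairwise
distances `D`, and distances are locally Lipschitz in the positions. -/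
theorem locallyLipschitz_field (s : Fin N₁ ⊕ Fin N₂ → Fin N₁ ⊕ Fin N₂ → ℝ) :
    LocallyLipschitz (field s) := by
  let ι := Fin N₁ ⊕ Fin N₂
  let U : (ι → ℝ) × (ι → ι → ℝ) → ι → ℝ := fun Q a =>
    ∑ i, Q.1 (Sum.inl i) * Real.exp (-Q.2 a (Sum.inl i))
  let V : (ι → ℝ) × (ι → ι → ℝ) → ι → ℝ := fun Q a =>
    ∑ j, Q.1 (Sum.inr j) * Real.exp (-Q.2 a (Sum.inr j))
  let U' : (ι → ℝ) × (ι → ι → ℝ) → ι → ℝ := fun Q a =>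
    -∑ i, Q.1 (Sum.inl i) * s a (Sum.inl i) * Real.exp (-Q.2 a (Sum.inl i))
  let V' : (ι → ℝ) × (ι → ι → ℝ) → ι → ℝ := fun Q a =>
    -∑ j, Q.1 (Sum.inr j) * s a (Sum.inr j) * Real.exp (-Q.2 a (Sum.inr j))
  let S : (ι → ℝ) × (ι → ι → ℝ) → (ι → ℝ) × (ι → ℝ) := fun Q =>
    (fun a => U Q a * V Q a, fun a => Q.1 a *
      Sum.elim (fun k => U Q (Sum.inl k) * V' Q (Sum.inl k)
          - 2 * U' Q (Sum.inl k) * V Q (Sum.inl k))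
        (fun k => U' Q (Sum.inr k) * V Q (Sum.inr k)
          - 2 * U Q (Sum.inr k) * V' Q (Sum.inr k)) a)
  have hS : ContDiff ℝ 1 S := by
    have hU : ∀ a, ContDiff ℝ 1 fun Q => U Q a := fun a => by
      simp only [U]; fun_prop
    have hV : ∀ a, ContDiff ℝ 1 fun Q => V Q a := fun a => by
      simp only [V]; fun_prop
    have hU' : ∀ a, ContDiff ℝ 1 fun Q => U' Q a := fun a => by
      simp only [U']; fun_prop
    have hV' : ∀ a, ContDiff ℝ 1 fun Q => V' Q a := fun a => by
      simp only [V']; fun_prop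
    refine ContDiff.prodMk (contDiff_pi.2 fun a => (hU a).mul (hV a)) (contDiff_pi.2 fun a => ?_)
    refine ContDiff.mul (by fun_prop) ?_
    rcases a with k | k
    · exact ((hU _).mul (hV' _)).sub ((contDiff_const.mul (hU' _)).mul (hV _))
    · exact ((hU' _).mul (hV _)).sub ((contDiff_const.mul (hU _)).mul (hV' _))
  let D : (ι → ℝ) × (ι → ℝ) → ι → ι → ℝ := fun P a b => |P.1 a - P.1 b|
  have hD : LocallyLipschitz D := by
    have h1 : ContDiff ℝ 1 fun (P : (ι → ℝ) × (ι → ℝ)) (a b : ι) => P.1 a - P.1 b := by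
      fun_prop
    have h2 : LipschitzWith 1 fun (f : ι → ι → ℝ) (a b : ι) => |f a b| := by
      refine LipschitzWith.of_dist_le_mul fun f g => ?_
      rw [NNReal.coe_one, one_mul]
      refine (dist_pi_le_iff dist_nonneg).2 fun a => (dist_pi_le_iff dist_nonneg).2 fun b => ?_
      exact (abs_abs_sub_abs_le_abs_sub _ _).trans
        ((dist_le_pi_dist (f a) (g a) b).trans (dist_le_pi_dist f g a))
    exact h2.locallyLipschitz.comp h1.locallyLipschitz
  have hsnd : LocallyLipschitz (Prod.snd : (ι → ℝ) × (ι → ℝ) → ι → ℝ) :=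
    LipschitzWith.prod_snd.locallyLipschitz
  have heq : field s = S ∘ fun P => (P.2, D P) := by
    funext P
    refine Prod.ext (funext fun a => ?_) (funext fun a => ?_)
    · rcases a with k | k <;> rfl
    · rcases a with k | k <;> rfl
  rw [heq]
  exact hS.locallyLipschitz.comp (hsnd.prodMk hD)

/-- Order preservation turns the frozen signs into the true ones, so the energy is conserved and `R`
depends only on `p₀` and `T`. -/
theorem exists_apriori_bound {p₀ : PeakonConfig N₁ N₂} (h₀ : p₀.IsPure) (t₀ : ℝ) {T : ℝ}
    (hT : 0 ≤ T) : ∃ R : ℝ, ∀ (c : ℝ → ℝ) (p : ℝ → PeakonConfig N₁ N₂),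
      (∀ t, c t ∈ Icc (0 : ℝ) 1) → p t₀ = p₀ →
      IsScaledSolutionOn c (fun _ => p₀.sgn) p (Icc (t₀ - T) (t₀ + T)) →
      ∀ t ∈ Icc (t₀ - T) (t₀ + T), ‖(p t).toPair‖ ≤ R := by
  have hE : 0 ≤ p₀.energy := Finset.sum_nonneg fun i _ => Finset.sum_nonneg fun j _ =>
    mul_nonneg (mul_nonneg (h₀.m_pos i).le (h₀.n_pos j).le) (Real.exp_pos _).le
  refine ⟨max (‖p₀.pos‖ + p₀.energy * T) (‖p₀.amp‖ * Real.exp (3 * p₀.energy * T)),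
    fun c p hc hp₀ h t ht => ?_⟩
  subst hp₀
  have hc' : ∀ t ∈ Icc (t₀ - T) (t₀ + T), |c t| ≤ 1 := fun t _ => by
    rw [abs_of_nonneg (hc t).1]; exact (hc t).2
  have ht₀ : t₀ ∈ Icc (t₀ - T) (t₀ + T) := ⟨by linarith, by linarith⟩
  have hpure := fun r (hr : r ∈ Icc (t₀ - T) (t₀ + T)) =>
    h.isPure_and_sameOrder isCompact_Icc ordConnected_Icc hc'
      (fun _ _ => abs_sgn_le_one _) ht₀ h₀ hr
  have hs := fun r hr => (hpure r hr).2.sgn_eq.symm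
  have htT : |t - t₀| ≤ T := abs_le.2 ⟨by linarith [ht.1], by linarith [ht.2]⟩
  refine max_le_max ?_ ?_
  · refine (pi_norm_le_iff_of_nonneg (by positivity)).2 fun a => ?_
    refine (h.abs_pos_le ordConnected_Icc hc' hs (fun r hr => (hpure r hr).1) ht₀ ht a).trans ?_
    exact add_le_add (norm_le_pi_norm (p t₀).pos a) (mul_le_mul_of_nonneg_left htT hE)
  · refine (pi_norm_le_iff_of_nonneg (by positivity)).2 fun a => ?_
    refine (h.abs_amp_le ordConnected_Icc hc' hs (fun r hr => (hpure r hr).1) ht₀ ht a).trans ?_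
    refine mul_le_mul (norm_le_pi_norm (p t₀).amp a) (Real.exp_le_exp.2 ?_) (Real.exp_pos _).le
      (norm_nonneg _)
    rw [abs_sub_comm]
    exact mul_le_mul_of_nonneg_left htT (by positivity)

end PeakonConfig

/-! ### No collisions and globality -/

open PeakonConfig

/-- `I` need not be compact, so the argument runs on the segment between `t₀` and `t`. -/
theorem IsPeakonSolutionOn.isPure_and_sameOrder {N₁ N₂ : ℕ} {q : ℝ → PeakonConfig N₁ N₂}
    {I : Set ℝ} (hq : IsPeakonSolutionOn q I) (hI : I.OrdConnected) {t₀ : ℝ} (ht₀ : t₀ ∈ I)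
    (h₀ : (q t₀).IsPure) {t : ℝ} (ht : t ∈ I) : (q t).IsPure ∧ (q t).SameOrder (q t₀) :=
  ((isPeakonSolutionOn_iff.1 hq).mono (hI.uIcc_subset ht₀ ht)).isPure_and_sameOrder
    isCompact_uIcc ordConnected_uIcc (by simp) (fun _ _ => abs_sgn_le_one _) left_mem_uIcc h₀
    right_mem_uIcc

theorem mainTheorem3 {N₁ N₂ : ℕ} (t₀ : ℝ) (p₀ : PeakonConfig N₁ N₂) (h₀ : p₀.IsPure) :
    -- no collisions: along every solution, on whatever time interval it is defined
    (∀ (I : Set ℝ) (q : ℝ → PeakonConfig N₁ N₂), I.OrdConnected → t₀ ∈ I →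
      IsPeakonSolutionOn q I → q t₀ = p₀ →
      ∀ t ∈ I, (q t).IsPure ∧ (q t).SameOrder p₀) ∧
    -- global existence; every solution is a restriction of the global one
    ∃ p : ℝ → PeakonConfig N₁ N₂, p t₀ = p₀ ∧ IsPeakonSolutionOn p univ ∧
      (∀ t : ℝ, (p t).IsPure ∧ (p t).SameOrder p₀) ∧
      ∀ (I : Set ℝ) (q : ℝ → PeakonConfig N₁ N₂), I.OrdConnected → t₀ ∈ I →
        IsPeakonSolutionOn q I → q t₀ = p₀ → EqOn q p I := by
  have hA : ∀ (I : Set ℝ) (q : ℝ → PeakonConfig N₁ N₂), I.OrdConnected → t₀ ∈ I →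
      IsPeakonSolutionOn q I → q t₀ = p₀ →
      ∀ t ∈ I, (q t).IsPure ∧ (q t).SameOrder p₀ := by
    rintro I q hI ht₀ hq rfl t ht
    exact hq.isPure_and_sameOrder hI ht₀ h₀ ht
  refine ⟨hA, ?_⟩
  have hF := locallyLipschitz_field p₀.sgn
  obtain ⟨γ, hγ₀, hγ⟩ := hF.exists_hasDerivAt_of_apriori_bound t₀ p₀.toPair fun T hT => by
    obtain ⟨R, hR⟩ := exists_apriori_bound h₀ t₀ hT
    refine ⟨R, fun c γ hc hγ₀ hγ t ht => ?_⟩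
    have hto : ∀ t, (ofPair (γ t)).toPair = γ t := fun t => by
      rw [toPair, pos_ofPair, amp_ofPair]
    have := hR c (fun t => ofPair (γ t)) hc (by rw [hγ₀, ofPair_toPair])
      (isScaledSolutionOn_iff.2 (by simpa only [hto] using hγ)) t ht
    rwa [hto] at this
  have hto : ∀ t, (ofPair (γ t)).toPair = γ t := fun t => by
    rw [toPair, pos_ofPair, amp_ofPair]
  have hp₀ : ofPair (γ t₀) = p₀ := by rw [hγ₀, ofPair_toPair]
  have hsol : IsScaledSolutionOn 1 (fun _ => p₀.sgn) (fun t => ofPair (γ t)) univ :=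
    isScaledSolutionOn_iff.2 fun t _ => by
      simpa only [hto, Pi.one_apply, one_smul] using (hγ t).hasDerivWithinAt
  have hpure : ∀ t, (ofPair (γ t)).IsPure ∧ (ofPair (γ t)).SameOrder p₀ := fun t => by
    have := (hsol.mono (subset_univ (uIcc t₀ t))).isPure_and_sameOrder isCompact_uIcc
      ordConnected_uIcc (by simp) (fun _ _ => abs_sgn_le_one _) left_mem_uIcc
      (by rwa [hp₀]) right_mem_uIcc
    rwa [hp₀] at this
  -- The order never changes, so the frozen system coincides with the original one along this curve.
  have hsgn : (fun _ : ℝ => p₀.sgn) = fun t => (ofPair (γ t)).sgn :=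
    funext fun t => (hpure t).2.sgn_eq.symm
  refine ⟨fun t => ofPair (γ t), hp₀, isPeakonSolutionOn_iff.2 (by rwa [hsgn] at hsol), hpure,
    fun I q hI ht₀ hq hq₀ => ?_⟩
  -- By part (a), `q` also solves the frozen system, whose locally Lipschitz field gives uniqueness.
  have hqsol : IsScaledSolutionOn 1 (fun _ => p₀.sgn) q I := by
    have h := isPeakonSolutionOn_iff.1 hq
    refine ⟨h.pos_ode, fun t ht a => ?_⟩
    rw [← (hA I q hI ht₀ hq hq₀ t ht).2.sgn_eq]
    exact h.amp_ode t ht a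
  have heq := hF.eqOn_of_hasDerivWithinAt hI ht₀ (f := fun t => (q t).toPair)
    (fun t ht => by simpa using isScaledSolutionOn_iff.1 hqsol t ht)
    (fun t _ => (hγ t).hasDerivWithinAt) (by rw [hq₀, hγ₀])
  intro t ht
  have := congrArg ofPair (heq ht)
  rwa [ofPair_toPair] at this
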